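/- **Setting.** There are $n$ replicas. An ordering vote is a finite list of distinct transactions; one vote extends another if the latter is an initial segment of it. For votes $\sigma=(\sigma_1,\dots,\sigma_n)$ let $V$ be the set of transactions that occur in every vote, and for distinct $\tau,\tau'\in V$ let $w(\tau,\tau')$ be the fraction of replicas that rank $\tau$ before $\tau'$. The streamed ordering graph has vertex set $V\cup\{\hat v\}$, where $\hat v$ is an additional "future" vertex, the weights $w(\tau,\tau')$, and $w(\tau,\hat v)=1$ for all $\tau\in V$; $w(\hat v,\tau)=1$ if some transaction that occurs in some but not all votes precedes $\tau$ in at least one vote, and $w(\hat v,\tau)=0$ otherwise. For $\tau\in V$ put $P_\tau=\{\tau'\neq\tau: w(\tau',\tau)=1\}$ and $R_\tau=\{\tau'\ne\tau: w(\tau',\tau)=0\}$, and let $U_{\tau,\tau'}=(V\setminus(R_\tau\cup P_{\tau'}))\cup\{\hat v\}$. **Algorithm (Streaming Ranked Pairs with dynamically generated tiebreaking).** An invocation on $\sigma$ may use the decisions of the preceding invocation (the oracle), which was made on votes that $\sigma$ extends, and which in turn may have used the one before it, and so on; the first invocation has no oracle. It builds a graph $H$ on $V\cup\{\hat v\}$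 whose edges are marked determinate or indeterminate. Initially $H$ consists of all edges of weight $1$ from or to $\hat v$, marked indeterminate. Then, for $k=n,n-1,\dots,0$ in turn, the edges $(\tau,\tau')$ between distinct transactions of $V$ with $w(\tau,\tau')=k/n$ are treated as follows. 1. Edges which the oracle included as determinate, or excluded, get the same decision. 2. The remaining ones are visited in an arbitrary order. If $H$ restricted to $U_{\tau,\tau'}$ has a directed path from $\tau'$ to $\tau$ all of whose edges are determinate, then $(\tau,\tau')$ is excluded; if it has no directed path from $\tau'$ to $\tau$ at all, then $(\tau,\tau')$ is added to $H$ as determinate; otherwise the edge is deferred. 3. The deferred edges are visited once more and decided by the same rule, except that an edge that would again be deferred is now added to $H$ as indeterminate. The output is a topological sort of $V$ with respect to the determinate edges of $H$, up to but not including the first transaction $\tau$ that borders an indeterminate edge other than $(\tau,\hat v)$. **Theorem.** The algorithm is asymptotically live, whatever the order in which undecided edges of equal weight are visited, whatever past invocations the oracle stems from, and whichever topological sort is taken. That is: let $\hat\sigma_1,\dots,\hat\sigma_n$ be orderings, each of order type $\omega$, of one and the same countably infinite set of transactions, and let $\tau$ be any transaction in this set. Then there exists an $N$ such that, when each $\hat\sigma_i$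 is truncated to its first $N$ elements to produce $\sigma_i$, the transaction $\tau$ is included in the output of the algorithm on $(\sigma_1,\dots,\sigma_n)$. -/

import Mathlib

namespace StreamingRP

/-! ### Ordering votes and ranking algorithms

There are `n` replicas.  An ordering vote is a finite list of transactions (earlier entries are
ranked earlier), and an infinite ordering preference is an injective sequence of transactions. -/

/-- One ordering vote from each of the `n` replicas. -/
abbrev Votes (n : ℕ) (T : Type*) := Fin n → List T

/-- A deterministic ranking algorithm: it maps a tuple of votes to an ordering (a list). -/
abbrev RankingAlgorithm (n : ℕ) (T : Type*) := Votes n T → List T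

/-- `v'` extends `v`: every vote of `v` is an initial segment of the corresponding vote of `v'`. -/
def Votes.ExtendedBy {n : ℕ} {T : Type*} (v v' : Votes n T) : Prop := ∀ i, v i <+: v' i

/-- The first `N` elements of each of the infinite orderings `σ i`. -/
def truncation {n : ℕ} {T : Type*} (σ : Fin n → ℕ → T) (N : ℕ) : Votes n T :=
  fun i => (List.range N).map (σ i)

/-- Asymptotic liveness: for all countably infinite ordering preferences `σ i` (no repetitions, and
every replica eventually votes on every transaction, so that all of them order the same set) and
every transaction `τ` in them, `τ` is in the output on the truncation to some finite length. -/
def AsymptoticallyLive {n : ℕ} {T : Type*} (A : RankingAlgorithm n T) : Prop :=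
  ∀ σ : Fin n → ℕ → T,
    (∀ i, Function.Injective (σ i)) →
    (∀ i j, Set.range (σ i) = Set.range (σ j)) →
    ∀ τ : T, (∃ i, τ ∈ Set.range (σ i)) →
      ∃ N : ℕ, τ ∈ A (truncation σ N)

/-! ### The streamed ordering graph

The vertices are the elements of `Option T`: `some τ` for a transaction `τ` that is in every vote,
and `none` for the additional "future" vertex. -/

/-- The transaction `a` is ranked before the transaction `b` in the vote `l`. -/
def Before {T : Type*} (l : List T) (a b : T) : Prop :=
  List.Sublist [a, b] l

open scoped Classical in
/-- The set `V` of all transactions that appear in every vote. -/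
noncomputable def common {n : ℕ} {T : Type*} (v : Votes n T) : Finset T :=
  (Finset.univ.biUnion fun i => (v i).toFinset).filter fun a => ∀ i, a ∈ v i

open scoped Classical in
/-- The fraction of the replicas that rank `a` before `b`. -/
noncomputable def weight {n : ℕ} {T : Type*} (v : Votes n T) (a b : T) : ℚ :=
  ((Finset.univ.filter fun i => Before (v i) a b).card : ℚ) / n

open scoped Classical in
/-- The weights of the streamed ordering graph.  (There are no loops: values at `(x, x)` are never
used.) -/
noncomputable def streamedWeight {n : ℕ} {T : Type*} (v : Votes n T) : Option T → Option T → ℚ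
  | some a, some b => weight v a b
  | some _, none => 1
  | none, some b =>
      if ∃ c, (∃ i, c ∈ v i) ∧ (∃ i, c ∉ v i) ∧ ∃ i, Before (v i) c b then 1 else 0
  | none, none => 0

/-- `P_τ`: the transactions other than `τ` that every replica ranks before `τ`. -/
def preceding {n : ℕ} {T : Type*} (v : Votes n T) (τ : T) : Set T :=
  {a | a ∈ common v ∧ a ≠ τ ∧ weight v a τ = 1}

/-- `R_τ`: the transactions other than `τ` that no replica ranks before `τ`. -/
def subsequent {n : ℕ} {T : Type*} (v : Votes n T) (τ : T) : Set T :=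
  {a | a ∈ common v ∧ a ≠ τ ∧ weight v a τ = 0}

/-- `U_{a,b} = (V \ (R_a ∪ P_b)) ∪ {future}`. -/
def localVertices {n : ℕ} {T : Type*} (v : Votes n T) (a b : T) : Set (Option T) :=
  insert none (some '' {c | c ∈ common v ∧ c ∉ subsequent v a ∧ c ∉ preceding v b})

/-! ### The algorithm -/

/-- The status of the edges considered so far.  The graph `H` consists of the determinate and the
indeterminate edges; `excluded` records the edges that were decided not to be in `H`.  Edges at the
future vertex are never determinate. -/
structure Status (T : Type*) where
  determinate : Set (T × T)
  indeterminate : Set (Option T × Option T)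
  excluded : Set (T × T)

/-- No edge has a status. -/
def Status.empty (T : Type*) : Status T := ⟨∅, ∅, ∅⟩

/-- The edge `e` has been accepted as determinate or has been excluded. -/
def Status.Decided {T : Type*} (s : Status T) (e : T × T) : Prop :=
  e ∈ s.determinate ∨ e ∈ s.excluded

/-- `x → y` is a determinate edge of `H`. -/
def Status.DetEdge {T : Type*} (s : Status T) (x y : Option T) : Prop :=
  ∃ a b, x = some a ∧ y = some b ∧ (a, b) ∈ s.determinate

/-- `x → y` is an edge of `H`, determinate or indeterminate. -/
def Status.AnyEdge {T : Type*} (s : Status T) (x y : Option T) : Prop :=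
  s.DetEdge x y ∨ (x, y) ∈ s.indeterminate

/-- There is a directed path from `x` to `y` along `E`, all of whose vertices lie in `U`. -/
def PathIn {X : Type*} (U : Set X) (E : X → X → Prop) (x y : X) : Prop :=
  Relation.TransGen (fun p q => p ∈ U ∧ q ∈ U ∧ E p q) x y

/-- A path of determinate edges, inside `U_{a,b}`, from `b` to `a`, where `e = (a, b)`. -/
def Status.DetPath {n : ℕ} {T : Type*} (s : Status T) (v : Votes n T) (e : T × T) : Prop :=
  PathIn (localVertices v e.1 e.2) s.DetEdge (some e.2) (some e.1)

/-- A path of determinate or indeterminate edges, inside `U_{a,b}`, from `b` to `a`, where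
`e = (a, b)`. -/
def Status.AnyPath {n : ℕ} {T : Type*} (s : Status T) (v : Votes n T) (e : T × T) : Prop :=
  PathIn (localVertices v e.1 e.2) s.AnyEdge (some e.2) (some e.1)

open scoped Classical in
/-- First visit to an edge: exclude it, or accept it as determinate, or (when it would become
indeterminate) leave it alone for the time being. -/
noncomputable def firstVisit {n : ℕ} {T : Type*} (v : Votes n T) (s : Status T) (e : T × T) :
    Status T :=
  if s.DetPath v e then { s with excluded := insert e s.excluded }
  else if ¬ s.AnyPath v e then { s with determinate := insert e s.determinate }
  else s

open scoped Classical in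
/-- Visit to a deferred edge: exclude it, or accept it as determinate, or add it to `H` as
indeterminate. -/
noncomputable def finalVisit {n : ℕ} {T : Type*} (v : Votes n T) (s : Status T) (e : T × T) :
    Status T :=
  if s.DetPath v e then { s with excluded := insert e s.excluded }
  else if ¬ s.AnyPath v e then { s with determinate := insert e s.determinate }
  else { s with indeterminate := insert (some e.1, some e.2) s.indeterminate }

/-- What the description of the algorithm leaves open.  A term of this type fixes
* in which order undecided edges of the same weight are visited (it may differ from one invocation
  to another);
* which past invocations, from the oldest to the latest, precede the invocation on the votes `v`;
  each of them ran on votes that the next one extends (there may be none);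
* which topological sort of a finite acyclic directed graph is taken. -/
structure Implementation (n : ℕ) (T : Type*) where
  order : Votes n T → Finset (T × T) → List (T × T)
  order_nodup : ∀ v s, (order v s).Nodup
  mem_order : ∀ v s e, e ∈ order v s ↔ e ∈ s
  past : Votes n T → List (Votes n T)
  past_chain : ∀ v, (past v ++ [v]).IsChain Votes.ExtendedBy
  sort : Finset T → Set (T × T) → List T
  sort_spec : ∀ (V : Finset T) (E : Set (T × T)),
    (∀ a, ¬ Relation.TransGen (fun x y => x ∈ V ∧ y ∈ V ∧ (x, y) ∈ E) a a) →
      (sort V E).Nodup ∧ (∀ a, a ∈ sort V E ↔ a ∈ V) ∧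
        (sort V E).Pairwise fun a b => (b, a) ∉ E

open scoped Classical in
/-- The edges between two different transactions whose weight is `k / n`. -/
noncomputable def weightClass {n : ℕ} {T : Type*} (v : Votes n T) (k : ℕ) : Finset (T × T) :=
  (common v).offDiag.filter fun e => streamedWeight v (some e.1) (some e.2) = (k : ℚ) / n

open scoped Classical in
/-- The treatment of the edges of weight `k / n`.  The decisions of the past invocation (the
oracle) are copied first; the remaining edges are then visited one after the other, and those that
would become indeterminate are deferred to the end. -/
noncomputable def classPass {n : ℕ} {T : Type*} (impl : Implementation n T) (oracle : Status T)
    (v : Votes n T) (s : Status T) (k : ℕ) : Status T :=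
  let copied : Status T :=
    { s with
      determinate := s.determinate ∪ {e | e ∈ weightClass v k ∧ e ∈ oracle.determinate}
      excluded := s.excluded ∪ {e | e ∈ weightClass v k ∧ e ∈ oracle.excluded} }
  let todo := impl.order v ((weightClass v k).filter fun e => ¬ oracle.Decided e)
  let visited := todo.foldl (firstVisit v) copied
  let deferred := todo.filter fun e => ¬ visited.Decided e
  deferred.foldl (finalVisit v) visited

/-- At the start, `H` consists of the edges of weight `1` at the future vertex, all of them
indeterminate. -/
def initialStatus {n : ℕ} {T : Type*} (v : Votes n T) : Status T where
  determinate := ∅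
  indeterminate := {e | ∃ a ∈ common v,
    (e = (some a, none) ∧ streamedWeight v (some a) none = 1) ∨
    (e = (none, some a) ∧ streamedWeight v none (some a) = 1)}
  excluded := ∅

/-- One invocation on the votes `v`: the weights `n/n, (n-1)/n, …, 0/n` are treated in decreasing
order. -/
noncomputable def invocation {n : ℕ} {T : Type*} (impl : Implementation n T) (oracle : Status T)
    (v : Votes n T) : Status T :=
  (List.range (n + 1)).reverse.foldl (classPass impl oracle v) (initialStatus v)

/-- The final status on the votes `v`: every invocation, from the oldest one to that on `v`, has
the result of the invocation before it as its oracle; the oldest one has an oracle without any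
decisions. -/
noncomputable def finalStatus {n : ℕ} {T : Type*} (impl : Implementation n T) (v : Votes n T) :
    Status T :=
  (impl.past v ++ [v]).foldl (invocation impl) (Status.empty T)

/-- The transaction `a` borders an indeterminate edge.  The edges from a transaction to the future
vertex, which exist for every transaction, do not count. -/
def Status.Borders {T : Type*} (s : Status T) (a : T) : Prop :=
  ∃ x, (x, some a) ∈ s.indeterminate ∨ (x ≠ none ∧ (some a, x) ∈ s.indeterminate)

open scoped Classical in
/-- Streaming Ranked Pairs with dynamically generated tiebreaking: the topological sort of `H` with
respect to its determinate edges, up to but not including the first transaction that borders an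
indeterminate edge. -/
noncomputable def streamingRankedPairs {n : ℕ} {T : Type*} (impl : Implementation n T) :
    RankingAlgorithm n T :=
  fun v =>
    let s := finalStatus impl v
    (impl.sort (common v) s.determinate).takeWhile fun a => ¬ s.Borders a

end StreamingRP

/-! The proof combines two facts: an indeterminate edge always has a local cause that disappears as
the votes grow, and determinate edges never form a cycle, so the topological sort is meaningful.

Local cause. During the first pass over a weight class, every indeterminate edge is strictly heavier
or borders the future vertex. A path that defers an edge must therefore leave the future vertex or
use a heavier indeterminate edge, inside `localVertices` (`Source`, `Status.AnyPath.detPath`). Apart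
from `a` and the future vertex, every local vertex of `(a, b)` precedes `a` in some vote, so all of
them stay in one finite set as the votes grow. Eventually the future vertex has no edge into this
set, and induction from heavy to light edges removes the other cause (`eventually_pair_notMem`).

Acyclicity. Copied decisions come from earlier votes, so the order of insertion in a single run
proves nothing. What survives is `Blocks`: an accepted edge closes no cycle with heavier edges, or
equally heavy earlier ones, in any extension of the votes. It holds on acceptance because a path in
an extension collapses to a path in the present graph, with the future vertex standing for every
transaction not yet common (`anyPath_of_extension`). `Valid.acyclic` applies it to the lightest,
latest edge of a cycle.

Conclusion. Fix a stage at which `τ` is common. The finitely many transactions occurring by then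
eventually border no relevant indeterminate edge; all others are unanimously ranked after `τ`, so a
determinate edge puts them behind `τ` in the sort. -/

namespace StreamingRP

/-! ### Precedence in finite lists -/

section Lists

variable {T : Type*}

theorem Before.mem_left {l : List T} {a b : T} (h : Before l a b) : a ∈ l :=
  List.Sublist.subset h (by simp)

theorem Before.mem_right {l : List T} {a b : T} (h : Before l a b) : b ∈ l :=
  List.Sublist.subset h (by simp)

theorem before_or_before {l : List T} {a b : T} (hab : a ≠ b) (ha : a ∈ l) (hb : b ∈ l) :
    Before l a b ∨ Before l b a := by
  induction l with
  | nil => simp at ha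
  | cons x t ih =>
    unfold Before at *
    rcases List.mem_cons.1 ha with rfl | ha'
    · left
      have : b ∈ t := (List.mem_cons.1 hb).resolve_left (Ne.symm hab)
      exact List.Sublist.cons_cons _ (List.singleton_sublist.2 this)
    · rcases List.mem_cons.1 hb with rfl | hb'
      · right
        exact List.Sublist.cons_cons _ (List.singleton_sublist.2 ha')
      · exact (ih ha' hb').imp (fun h => h.cons _) (fun h => h.cons _)

open scoped Classical in
theorem Before.idxOf_lt {l : List T} {a b : T} (hl : l.Nodup) (h : Before l a b) :
    l.idxOf a < l.idxOf b := by
  unfold Before at h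
  induction l with
  | nil => simp at h
  | cons x t ih =>
    obtain ⟨hx, ht⟩ := List.nodup_cons.1 hl
    cases h with
    | cons _ h' =>
      have ha : x ≠ a := fun e => hx (e ▸ Before.mem_left h')
      have hb : x ≠ b := fun e => hx (e ▸ Before.mem_right h')
      rw [List.idxOf_cons_ne _ ha, List.idxOf_cons_ne _ hb]
      exact Nat.succ_lt_succ (ih ht h')
    | cons_cons _ h' =>
      have hb : a ≠ b := fun e => hx (e ▸ List.singleton_sublist.1 h')
      rw [List.idxOf_cons_ne _ hb, List.idxOf_cons_self]
      exact Nat.succ_pos _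

theorem Before.asymm {l : List T} {a b : T} (hl : l.Nodup) (h : Before l a b) :
    ¬ Before l b a := fun h' => by
  classical
  exact lt_asymm (h.idxOf_lt hl) (h'.idxOf_lt hl)

/-- Without repetitions the appended part cannot contain `b`, so whatever precedes `b` is already in
the initial segment. Here `a` may be any transaction; hence the predecessors of a transaction are
fixed once it has been voted on. -/
theorem before_iff_of_prefix {l l' : List T} (hp : l <+: l') (hl : l'.Nodup) {a b : T}
    (hb : b ∈ l) : Before l' a b ↔ Before l a b := by
  obtain ⟨t, rfl⟩ := hp
  refine ⟨fun h => ?_, fun h => List.Sublist.trans h (List.sublist_append_left _ _)⟩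
  have hbt : b ∉ t := fun h => (List.disjoint_of_nodup_append hl) hb h
  obtain ⟨l₁, l₂, he, h₁, h₂⟩ := List.sublist_append_iff.1 h
  rcases List.eq_nil_or_concat l₂ with rfl | ⟨l₃, x, rfl⟩
  · rw [List.append_nil] at he
    rwa [Before, he]
  · exfalso
    have : b = x := by
      have := congrArg List.getLast? he
      simpa using this
    exact hbt (h₂.subset (by simp [this]))

theorem mem_takeWhile_of_pairwise {l : List T} {R : T → T → Prop} {p : T → Bool} {a : T}
    (hl : l.Pairwise R) (ha : a ∈ l) (hpa : p a = true)
    (h : ∀ x ∈ l, p x = false → ¬ R x a) : a ∈ l.takeWhile p := by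
  induction l with
  | nil => simp at ha
  | cons x t ih =>
    obtain ⟨hx, ht⟩ := List.pairwise_cons.1 hl
    rcases List.mem_cons.1 ha with rfl | ha'
    · simp [hpa]
    · have hpx : p x = true := by
        by_contra hne
        exact h x (by simp) (by simpa using hne) (hx a ha')
      rw [List.takeWhile_cons_of_pos hpx]
      exact List.mem_cons_of_mem _ (ih ht ha' fun y hy => h y (List.mem_cons_of_mem _ hy))

end Lists

/-! ### Walks in directed graphs -/

section Relations

variable {X : Type*}

/-- Cut the walk before its first and after its last use of the new edge. -/
theorem transGen_insert_edge {E : X → X → Prop} {a b x y : X}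
    (h : Relation.TransGen (fun p q => E p q ∨ (p = a ∧ q = b)) x y) :
    Relation.TransGen E x y ∨ (Relation.ReflTransGen E x a ∧ Relation.ReflTransGen E b y) := by
  induction h with
  | single h =>
    rcases h with h | ⟨rfl, rfl⟩
    · exact .inl (.single h)
    · exact .inr ⟨.refl, .refl⟩
  | tail _ h ih =>
    rcases h with h | ⟨rfl, rfl⟩
    · exact ih.imp (fun h' => h'.tail h) (fun h' => ⟨h'.1, h'.2.tail h⟩)
    · exact .inr ⟨ih.elim (fun h' => h'.to_reflTransGen) (fun h' => h'.1), .refl⟩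

theorem transGen_restrict {E : X → X → Prop} {U : Set X} {x y : X}
    (h : Relation.TransGen E x y)
    (hU : ∀ z, Relation.ReflTransGen E x z → Relation.ReflTransGen E z y → z ∈ U) :
    Relation.TransGen (fun p q => p ∈ U ∧ q ∈ U ∧ E p q) x y := by
  have key : ∀ z, Relation.TransGen E x z → Relation.ReflTransGen E z y →
      Relation.TransGen (fun p q => p ∈ U ∧ q ∈ U ∧ E p q) x z := by
    intro z hz
    induction hz with
    | single e =>
      intro hy
      exact .single ⟨hU _ .refl (.head e hy), hU _ (.single e) hy, e⟩
    | tail hp e ih =>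
      intro hy
      exact (ih (.head e hy)).tail
        ⟨hU _ hp.to_reflTransGen (.head e hy), hU _ (hp.tail e).to_reflTransGen hy, e⟩
  exact key y h .refl

/-- A walk that enters `z` cannot leave it, so one that ends elsewhere never does. This is applied
with `z` the future vertex. -/
theorem transGen_of_dead_end {E F : X → X → Prop} {z x y : X} (hzy : z ≠ y)
    (hE : ∀ p q, E p q → F p q ∨ q = z) (hz : ∀ q, ¬ E z q)
    (h : Relation.TransGen E x y) : Relation.TransGen F x y := by
  induction h using Relation.TransGen.head_induction_on with
  | single e => exact .single ((hE _ _ e).resolve_right (Ne.symm hzy))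
  | head e hp ih =>
    refine .head ((hE _ _ e).resolve_right ?_) ih
    rintro rfl
    obtain ⟨q, hq, -⟩ := Relation.TransGen.head'_iff.1 hp
    exact hz q hq

end Relations

/-! ### Integer weights and extensions of votes -/

section Support

variable {n : ℕ} {T : Type*}

open scoped Classical in
/-- The number of replicas that rank `a` before `b`. -/
noncomputable def support (v : Votes n T) (a b : T) : ℕ :=
  (Finset.univ.filter fun i => Before (v i) a b).card

theorem weight_eq_support_div (v : Votes n T) (a b : T) :
    weight v a b = (support v a b : ℚ) / n := rfl

theorem support_le (v : Votes n T) (a b : T) : support v a b ≤ n := by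
  classical
  exact (Finset.card_le_univ _).trans (by simp)

theorem support_ne_zero {v : Votes n T} {a b : T} :
    support v a b ≠ 0 ↔ ∃ i, Before (v i) a b := by
  classical
  rw [← Nat.pos_iff_ne_zero, support, Finset.card_pos]
  simp [Finset.Nonempty]

theorem support_eq_iff {v : Votes n T} {a b : T} :
    support v a b = n ↔ ∀ i, Before (v i) a b := by
  classical
  have h := Finset.card_eq_iff_eq_univ (Finset.univ.filter fun i => Before (v i) a b)
  rw [Fintype.card_fin] at h
  rw [support, h, Finset.filter_eq_self]
  simp

theorem weight_eq_div_iff (hn : 0 < n) {v : Votes n T} {a b : T} {k : ℕ} :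
    weight v a b = (k : ℚ) / n ↔ support v a b = k := by
  have : (n : ℚ) ≠ 0 := by positivity
  rw [weight_eq_support_div, div_left_inj' this, Nat.cast_inj]

theorem weight_eq_one_iff (hn : 0 < n) {v : Votes n T} {a b : T} :
    weight v a b = 1 ↔ support v a b = n := by
  have : (n : ℚ) ≠ 0 := by positivity
  rw [← weight_eq_div_iff hn, div_self this]

theorem weight_eq_zero_iff (hn : 0 < n) {v : Votes n T} {a b : T} :
    weight v a b = 0 ↔ support v a b = 0 := by
  rw [← weight_eq_div_iff hn]
  simp

theorem mem_common (hn : 0 < n) {v : Votes n T} {a : T} : a ∈ common v ↔ ∀ i, a ∈ v i := by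
  classical
  simp only [common, Finset.mem_filter, Finset.mem_biUnion, Finset.mem_univ, true_and,
    List.mem_toFinset, and_iff_right_iff_imp]
  exact fun h => ⟨⟨0, hn⟩, h _⟩

/-- Two different transactions that both occur in every vote. -/
def IsPair (v : Votes n T) (e : T × T) : Prop :=
  e.1 ∈ common v ∧ e.2 ∈ common v ∧ e.1 ≠ e.2

theorem IsPair.swap {v : Votes n T} {a b : T} (h : IsPair v (a, b)) : IsPair v (b, a) :=
  ⟨h.2.1, h.1, h.2.2.symm⟩

theorem mem_weightClass (hn : 0 < n) {v : Votes n T} {k : ℕ} {e : T × T} :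
    e ∈ weightClass v k ↔ IsPair v e ∧ support v e.1 e.2 = k := by
  classical
  rw [weightClass, Finset.mem_filter, Finset.mem_offDiag, streamedWeight, weight_eq_div_iff hn]
  rfl

theorem support_swap_of_eq_zero (hn : 0 < n) {v : Votes n T} {a b : T} (h : IsPair v (a, b))
    (h0 : support v a b = 0) : support v b a = n := by
  rw [support_eq_iff]
  intro i
  refine (before_or_before h.2.2 ((mem_common hn).1 h.1 i)
    ((mem_common hn).1 h.2.1 i)).resolve_left fun hb => ?_
  exact support_ne_zero.2 ⟨i, hb⟩ h0

theorem support_swap_of_eq_card {v : Votes n T} (hv : ∀ i, (v i).Nodup) {a b : T}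
    (h : support v a b = n) : support v b a = 0 := by
  by_contra h0
  obtain ⟨i, hi⟩ := support_ne_zero.1 h0
  exact hi.asymm (hv i) (support_eq_iff.1 h i)

theorem some_mem_localVertices (hn : 0 < n) {v : Votes n T} {a b c : T} :
    some c ∈ localVertices v a b ↔
      c ∈ common v ∧ (c = a ∨ support v c a ≠ 0) ∧ (c = b ∨ support v c b ≠ n) := by
  simp only [localVertices, Set.mem_insert_iff, reduceCtorEq, false_or, Set.mem_image,
    Option.some.injEq, exists_eq_right, Set.mem_ofPred_eq, subsequent, preceding,
    weight_eq_zero_iff hn, weight_eq_one_iff hn]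
  tauto

theorem Votes.ExtendedBy.refl (v : Votes n T) : v.ExtendedBy v := fun _ => List.prefix_rfl

theorem Votes.ExtendedBy.trans {v v' v'' : Votes n T} (h : v.ExtendedBy v')
    (h' : v'.ExtendedBy v'') : v.ExtendedBy v'' := fun i => (h i).trans (h' i)

theorem Votes.ExtendedBy.nodup {v v' : Votes n T} (h : v.ExtendedBy v')
    (hv : ∀ i, (v' i).Nodup) (i : Fin n) : (v i).Nodup := (h i).sublist.nodup (hv i)

theorem Votes.ExtendedBy.mem_common (hn : 0 < n) {v v' : Votes n T} (h : v.ExtendedBy v')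
    {a : T} (ha : a ∈ common v) : a ∈ common v' := by
  rw [StreamingRP.mem_common hn] at *
  exact fun i => (h i).subset (ha i)

theorem Votes.ExtendedBy.isPair (hn : 0 < n) {v v' : Votes n T} (h : v.ExtendedBy v')
    {e : T × T} (he : IsPair v e) : IsPair v' e :=
  ⟨h.mem_common hn he.1, h.mem_common hn he.2.1, he.2.2⟩

/-- Weights are frozen once the head is common. Decisions of different invocations can therefore be
compared by weight. -/
theorem Votes.ExtendedBy.support_eq (hn : 0 < n) {v v' : Votes n T} (h : v.ExtendedBy v')
    (hv : ∀ i, (v' i).Nodup) (a : T) {b : T} (hb : b ∈ common v) :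
    support v' a b = support v a b := by
  classical
  unfold support
  congr 1
  ext i
  simp only [Finset.mem_filter, Finset.mem_univ, true_and]
  exact before_iff_of_prefix (h i) (hv i) ((StreamingRP.mem_common hn).1 hb i)

end Support

/-! ### Invariants of the decisions -/

section Invariants

variable {n : ℕ} {T : Type*}

/-- The edge `e` closes no cycle, in any extension `v'` of the votes `v`: the edges of `D` which
are not in `X`, and which are heavier than `e` or equally heavy and in `M` before `e`, contain no
path from the head of `e` to its tail. -/
def Blocks (v : Votes n T) (M X : Set (T × T)) (r : T × T → ℕ) (e : T × T) : Prop :=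
  ∀ (v' : Votes n T) (D : Set (T × T)), v.ExtendedBy v' → (∀ i, (v' i).Nodup) →
    (∀ f ∈ D, f ∉ X) → (∀ f ∈ D, IsPair v' f ∧ support v' f.1 f.2 ≠ 0) →
    ¬ Relation.TransGen (fun x y =>
      some x ∈ localVertices v' e.1 e.2 ∧ some y ∈ localVertices v' e.1 e.2 ∧ (x, y) ∈ D ∧
        (support v' e.1 e.2 < support v' x y ∨
          (support v' x y = support v' e.1 e.2 ∧ (x, y) ∈ M ∧ (x, y) ≠ e ∧ r (x, y) ≤ r e)))
      e.2 e.1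

/-- What is preserved of the sets `M` of determinate and `X` of excluded edges from one invocation
to the next. -/
structure Valid (v : Votes n T) (M X : Set (T × T)) : Prop where
  pair_det : ∀ e ∈ M, IsPair v e
  pair_excl : ∀ e ∈ X, IsPair v e
  disjoint : ∀ e ∈ M, e ∉ X
  det_ne_zero : ∀ e ∈ M, support v e.1 e.2 ≠ 0
  excl_ne_card : ∀ e ∈ X, support v e.1 e.2 ≠ n
  blocks : ∃ (r : T × T → ℕ) (B : ℕ), ∀ e ∈ M, r e < B ∧ Blocks v M X r e

theorem Valid.empty (v : Votes n T) : Valid v ∅ ∅ where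
  pair_det := by simp
  pair_excl := by simp
  disjoint := by simp
  det_ne_zero := by simp
  excl_ne_card := by simp
  blocks := ⟨fun _ => 0, 0, by simp⟩

theorem Valid.extend (hn : 0 < n) {v v' : Votes n T} {M X : Set (T × T)} (h : Valid v M X)
    (hvv : v.ExtendedBy v') (hv : ∀ i, (v' i).Nodup) : Valid v' M X where
  pair_det e he := hvv.isPair hn (h.pair_det e he)
  pair_excl e he := hvv.isPair hn (h.pair_excl e he)
  disjoint := h.disjoint
  det_ne_zero e he := by
    rw [hvv.support_eq hn hv _ (h.pair_det e he).2.1]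
    exact h.det_ne_zero e he
  excl_ne_card e he := by
    rw [hvv.support_eq hn hv _ (h.pair_excl e he).2.1]
    exact h.excl_ne_card e he
  blocks := by
    obtain ⟨r, B, hr⟩ := h.blocks
    exact ⟨r, B, fun e he => ⟨(hr e he).1, fun v'' D hv'' => (hr e he).2 v'' D (hvv.trans hv'')⟩⟩

/-- A larger `X` leaves fewer sets `D` to test in `Blocks`. -/
theorem Valid.insert_excl {v : Votes n T} {M X : Set (T × T)} (h : Valid v M X) {e : T × T}
    (he : IsPair v e) (heM : e ∉ M) (hne : support v e.1 e.2 ≠ n) : Valid v M (insert e X) where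
  pair_det := h.pair_det
  pair_excl := by
    rintro f (rfl | hf)
    exacts [he, h.pair_excl f hf]
  disjoint := by
    rintro f hf (rfl | hf')
    exacts [heM hf, h.disjoint f hf hf']
  det_ne_zero := h.det_ne_zero
  excl_ne_card := by
    rintro f (rfl | hf)
    exacts [hne, h.excl_ne_card f hf]
  blocks := by
    obtain ⟨r, B, hr⟩ := h.blocks
    exact ⟨r, B, fun f hf => ⟨(hr f hf).1, fun v' D hvv hv hD =>
      (hr f hf).2 v' D hvv hv fun g hg hgX => hD g hg (Set.mem_insert_of_mem _ hgX)⟩⟩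

theorem Valid.insert_det {v : Votes n T} {M X : Set (T × T)} (h : Valid v M X) {e : T × T}
    (he : IsPair v e) (heM : e ∉ M) (heX : e ∉ X) (hne : support v e.1 e.2 ≠ 0)
    (hpath : ∀ (v' : Votes n T) (D : Set (T × T)), v.ExtendedBy v' → (∀ i, (v' i).Nodup) →
      (∀ f ∈ D, f ∉ X) → (∀ f ∈ D, IsPair v' f ∧ support v' f.1 f.2 ≠ 0) →
      ¬ Relation.TransGen (fun x y =>
        some x ∈ localVertices v' e.1 e.2 ∧ some y ∈ localVertices v' e.1 e.2 ∧ (x, y) ∈ D ∧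
          (support v' e.1 e.2 < support v' x y ∨
            (support v' x y = support v' e.1 e.2 ∧ (x, y) ∈ M))) e.2 e.1) :
    Valid v (insert e M) X where
  pair_det := by
    rintro f (rfl | hf)
    exacts [he, h.pair_det f hf]
  pair_excl := h.pair_excl
  disjoint := by
    rintro f (rfl | hf)
    exacts [heX, h.disjoint f hf]
  det_ne_zero := by
    rintro f (rfl | hf)
    exacts [hne, h.det_ne_zero f hf]
  excl_ne_card := h.excl_ne_card
  blocks := by
    classical
    obtain ⟨r, B, hr⟩ := h.blocks
    -- Rank `B` places `e` after all earlier determinate edges, so their `Blocks` conditions do not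
    -- count it among equally heavy edges; as a heavier edge it was already allowed for in `D`.
    refine ⟨Function.update r e B, B + 1, ?_⟩
    rintro f (rfl | hf)
    · refine ⟨by simp, fun v' D hvv hv hD hD' hp => hpath v' D hvv hv hD hD' (Relation.TransGen.mono ?_ _ _ hp)⟩
      rintro x y ⟨hx, hy, hxy, h'⟩
      exact ⟨hx, hy, hxy, h'.imp_right fun h'' => ⟨h''.1, h''.2.1.resolve_left h''.2.2.1⟩⟩
    · have hfe : f ≠ e := fun h' => heM (h' ▸ hf)
      have hrf := (hr f hf).1
      rw [Function.update_of_ne hfe]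
      refine ⟨by omega, fun v' D hvv hv hD hD' hp => (hr f hf).2 v' D hvv hv hD hD' (Relation.TransGen.mono ?_ _ _ hp)⟩
      rintro x y ⟨hx, hy, hxy, h'⟩
      refine ⟨hx, hy, hxy, h'.imp_right ?_⟩
      rintro ⟨h₁, h₂, h₃, h₄⟩
      rw [Function.update_of_ne hfe] at h₄
      by_cases hxe : (x, y) = e
      · rw [hxe, Function.update_self] at h₄
        omega
      · rw [Function.update_of_ne hxe] at h₄
        exact ⟨h₁, h₂.resolve_left hxe, h₃, h₄⟩

/-- The reason for which an edge `e` can be indeterminate: inside its set of local vertices, the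
indeterminate edges `I` contain an edge from the future vertex or an edge heavier than `e`. -/
def Source (v : Votes n T) (I : Set (Option T × Option T)) (e : T × T) : Prop :=
  (∃ y, some y ∈ localVertices v e.1 e.2 ∧ (none, some y) ∈ I) ∨
  ∃ c d, some c ∈ localVertices v e.1 e.2 ∧ some d ∈ localVertices v e.1 e.2 ∧
    (some c, some d) ∈ I ∧ support v e.1 e.2 < support v c d

theorem Source.mono {v : Votes n T} {I J : Set (Option T × Option T)} {e : T × T} (h : I ⊆ J)
    (hs : Source v I e) : Source v J e := by
  rcases hs with ⟨y, hy, hI⟩ | ⟨c, d, hc, hd, hI, hlt⟩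
  exacts [.inl ⟨y, hy, h hI⟩, .inr ⟨c, d, hc, hd, h hI, hlt⟩]

/-- Without a source, the path can use no indeterminate edge between transactions and none out of
the future vertex. Only edges into the future vertex remain, and that vertex is then a dead end. -/
theorem Status.AnyPath.detPath {v : Votes n T} {s : Status T} {e : T × T} (h : s.AnyPath v e)
    (hI : ∀ c d, (some c, some d) ∈ s.indeterminate → support v e.1 e.2 < support v c d)
    (hnone : (none, none) ∉ s.indeterminate) (hs : ¬ Source v s.indeterminate e) :
    s.DetPath v e := by
  refine transGen_of_dead_end (z := none) (by simp) ?_ ?_ h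
  · rintro p (_ | d) ⟨hp, hq, he⟩
    · exact .inr rfl
    · left
      rcases he with he | he
      · exact ⟨hp, hq, he⟩
      · rcases p with _ | c
        · exact absurd (.inl ⟨d, hq, he⟩) hs
        · exact absurd (.inr ⟨c, d, hp, hq, he, hI c d he⟩) hs
  · rintro (_ | d) ⟨-, hq, he⟩
    · rcases he with ⟨a, b, ha, -⟩ | he
      · cases ha
      · exact hnone he
    · rcases he with ⟨a, b, ha, -⟩ | he
      · cases ha
      · exact hs (.inl ⟨d, hq, he⟩)

theorem PathIn.head_mem {X : Type*} {U : Set X} {E : X → X → Prop} {x y : X}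
    (h : PathIn U E x y) : x ∈ U := by
  obtain ⟨z, hz, -⟩ := Relation.TransGen.head'_iff.1 h
  exact hz.1

/-- A path back to the tail must start inside the local vertices, which excludes the head of a
unanimous edge. Hence unanimous edges are neither excluded nor made indeterminate. -/
theorem support_ne_card_of_head_mem (hn : 0 < n) {v : Votes n T} (hv : ∀ i, (v i).Nodup)
    {e : T × T} (he : IsPair v e) (h : some e.2 ∈ localVertices v e.1 e.2) :
    support v e.1 e.2 ≠ n := by
  intro hc
  rcases ((some_mem_localVertices hn).1 h).2.1 with h' | h'
  exacts [he.2.2 h'.symm, h' (support_swap_of_eq_card hv hc)]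

theorem Status.DetPath.anyPath {v : Votes n T} {s : Status T} {e : T × T} (h : s.DetPath v e) :
    s.AnyPath v e :=
  Relation.TransGen.mono (fun _ _ h' => ⟨h'.1, h'.2.1, .inl h'.2.2⟩) _ _ h

/-- The status `s` in the course of the invocation on `v` with oracle `o`: the edges of support at
least `c` have been decided, and the oracle's decisions on those of support at least `k` have been
copied. -/
structure Stage (v : Votes n T) (o : Status T) (c k : ℕ) (s : Status T) : Prop where
  valid : Valid v (o.determinate ∪ s.determinate) (o.excluded ∪ s.excluded)
  init : (initialStatus v).indeterminate ⊆ s.indeterminate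
  indet : ∀ x y, (x, y) ∈ s.indeterminate → (x, y) ∈ (initialStatus v).indeterminate ∨
    ∃ a b, x = some a ∧ y = some b ∧ IsPair v (a, b) ∧ k ≤ support v a b ∧
      support v a b ≠ 0 ∧ support v a b ≠ n
  source : ∀ a b, (some a, some b) ∈ s.indeterminate → Source v s.indeterminate (a, b)
  le_of_det : ∀ e ∈ s.determinate, k ≤ support v e.1 e.2
  le_of_excl : ∀ e ∈ s.excluded, k ≤ support v e.1 e.2
  copy_det : ∀ e ∈ o.determinate, k ≤ support v e.1 e.2 → e ∈ s.determinate
  copy_excl : ∀ e ∈ o.excluded, k ≤ support v e.1 e.2 → e ∈ s.excluded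
  cover : ∀ e, IsPair v e → c ≤ support v e.1 e.2 →
    s.Decided e ∨ (some e.1, some e.2) ∈ s.indeterminate

theorem none_none_notMem_initialStatus (v : Votes n T) :
    (none, none) ∉ (initialStatus v).indeterminate := by
  rintro ⟨a, -, ⟨h, -⟩ | ⟨h, -⟩⟩ <;> simp at h

theorem some_some_notMem_initialStatus (v : Votes n T) (a b : T) :
    (some a, some b) ∉ (initialStatus v).indeterminate := by
  rintro ⟨c, -, ⟨h, -⟩ | ⟨h, -⟩⟩ <;> simp at h

theorem some_none_mem_initialStatus {v : Votes n T} {a : T} (ha : a ∈ common v) :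
    (some a, none) ∈ (initialStatus v).indeterminate := ⟨a, ha, .inl ⟨rfl, rfl⟩⟩

theorem none_some_mem_initialStatus {v : Votes n T} {a : T} :
    (none, some a) ∈ (initialStatus v).indeterminate ↔ a ∈ common v ∧
      ∃ c, (∃ i, c ∈ v i) ∧ (∃ i, c ∉ v i) ∧ ∃ i, Before (v i) c a := by
  constructor
  · rintro ⟨b, hb, ⟨h, -⟩ | ⟨h, hw⟩⟩
    · simp at h
    · obtain rfl : a = b := by simpa using h
      refine ⟨hb, ?_⟩
      by_contra hc
      simp [streamedWeight, hc] at hw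
  · rintro ⟨ha, hc⟩
    exact ⟨a, ha, .inr ⟨rfl, by rw [streamedWeight, if_pos hc]⟩⟩

theorem Stage.none_none_notMem {v : Votes n T} {o s : Status T} {c k : ℕ}
    (h : Stage v o c k s) : (none, none) ∉ s.indeterminate := by
  intro h'
  rcases h.indet _ _ h' with h'' | ⟨a, b, ha, -⟩
  · exact none_none_notMem_initialStatus v h''
  · cases ha

theorem Stage.indet_pair {v : Votes n T} {o s : Status T} {c k : ℕ} (h : Stage v o c k s)
    {a b : T} (hab : (some a, some b) ∈ s.indeterminate) :
    IsPair v (a, b) ∧ k ≤ support v a b ∧ support v a b ≠ 0 ∧ support v a b ≠ n := by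
  rcases h.indet _ _ hab with h' | ⟨c, d, hc, hd, h'⟩
  · exact absurd h' (some_some_notMem_initialStatus v a b)
  · cases hc
    cases hd
    exact h'

theorem Stage.mem_det_of_support_eq {v : Votes n T} {o s : Status T} {c k : ℕ}
    (h : Stage v o c k s) (hc : c ≤ n) {e : T × T} (he : IsPair v e)
    (hs : support v e.1 e.2 = n) : e ∈ s.determinate := by
  rcases h.cover e he (hs.symm ▸ hc) with (h' | h') | h'
  · exact h'
  · exact absurd hs (h.valid.excl_ne_card e (.inr h'))
  · exact absurd hs (h.indet_pair h').2.2.2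

/-- A path in the extension `v'` gives rise to a path in `v`, in which the future vertex stands for
the transactions that are not in every vote of `v`. -/
theorem anyPath_of_extension (hn : 0 < n) {v v' : Votes n T} {s : Status T} {e : T × T}
    (hvv : v.ExtendedBy v') (hv : ∀ i, (v' i).Nodup) (he : IsPair v e)
    (hinit : (initialStatus v).indeterminate ⊆ s.indeterminate) {E : T → T → Prop}
    (hE : ∀ x y, E x y → some x ∈ localVertices v' e.1 e.2 ∧ some y ∈ localVertices v' e.1 e.2 ∧
      support v' x y ≠ 0)
    (hs : ∀ x y, E x y → x ∈ common v → y ∈ common v → s.AnyEdge (some x) (some y))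
    (h : Relation.TransGen E e.2 e.1) : s.AnyPath v e := by
  classical
  -- Collapse all transactions that are not yet common to the future vertex.
  let φ : T → Option T := fun x => if x ∈ common v then some x else none
  have hU : ∀ x, some x ∈ localVertices v' e.1 e.2 → φ x ∈ localVertices v e.1 e.2 := by
    intro x hx
    by_cases hxc : x ∈ common v
    · simp only [φ, if_pos hxc]
      rw [some_mem_localVertices hn] at hx ⊢
      rw [hvv.support_eq hn hv _ he.1, hvv.support_eq hn hv _ he.2.1] at hx
      exact ⟨hxc, hx.2⟩
    · simp only [φ, if_neg hxc]
      exact Set.mem_insert _ _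
  -- The reflexive closure is needed because an edge between two collapsed transactions becomes a
  -- point; the walk is nonempty in the end since its endpoints differ.
  have key : Relation.ReflTransGen (fun p q => p ∈ localVertices v e.1 e.2 ∧
      q ∈ localVertices v e.1 e.2 ∧ s.AnyEdge p q) (φ e.2) (φ e.1) := by
    refine Relation.ReflTransGen.lift' φ (fun x y hxy => ?_) _ _ h.to_reflTransGen
    obtain ⟨hx, hy, hne⟩ := hE x y hxy
    change Relation.ReflTransGen _ (φ x) (φ y)
    have hx' := hU x hx
    have hy' := hU y hy
    by_cases hxc : x ∈ common v <;> by_cases hyc : y ∈ common v <;>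
      simp only [φ, hxc, hyc, if_true, if_false] at hx' hy' ⊢
    · exact .single ⟨hx', hy', hs x y hxy hxc hyc⟩
    · exact .single ⟨hx', hy', .inr (hinit (some_none_mem_initialStatus hxc))⟩
    · refine .single ⟨hx', hy', .inr (hinit (none_some_mem_initialStatus.2 ⟨hyc, x, ?_⟩))⟩
      rw [hvv.support_eq hn hv _ hyc] at hne
      obtain ⟨i, hi⟩ := support_ne_zero.1 hne
      rw [mem_common hn, not_forall] at hxc
      exact ⟨⟨i, hi.mem_left⟩, hxc, i, hi⟩
    · exact .refl
  simp only [φ, he.1, he.2.1, if_true] at key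
  refine (Relation.reflTransGen_iff_eq_or_transGen.1 key).resolve_left ?_
  simpa using he.2.2

/-- The reverse of an edge of weight zero is unanimous, hence already determinate, and is by itself
a path that excludes the edge. -/
theorem Stage.support_ne_zero_of_not_detPath (hn : 0 < n) {v : Votes n T} {o s : Status T} {k : ℕ}
    (h : Stage v o (k + 1) k s) {e : T × T} (he : IsPair v e) (hk : support v e.1 e.2 = k)
    (hp : ¬ s.DetPath v e) : support v e.1 e.2 ≠ 0 := by
  intro h0
  have hsw : support v e.2 e.1 = n := support_swap_of_eq_zero hn he h0
  have hdet := h.mem_det_of_support_eq (by omega) (e := (e.2, e.1)) (IsPair.swap he) hsw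
  refine hp (.single ⟨?_, ?_, e.2, e.1, rfl, rfl, hdet⟩)
  · exact (some_mem_localVertices hn).2 ⟨he.2.1, .inr (by omega), .inl rfl⟩
  · exact (some_mem_localVertices hn).2 ⟨he.1, .inl rfl, .inr (by omega)⟩

/-- Neither the oracle `o` nor the status `s` has decided the edge `e`. -/
def Fresh (o s : Status T) (e : T × T) : Prop := ¬ o.Decided e ∧ ¬ s.Decided e

theorem Stage.exclude (hn : 0 < n) {v : Votes n T} (hv : ∀ i, (v i).Nodup) {o s : Status T}
    {k : ℕ} (h : Stage v o (k + 1) k s) {e : T × T} (he : IsPair v e)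
    (hk : support v e.1 e.2 = k) (hf : Fresh o s e) (hp : s.DetPath v e) :
    Stage v o (k + 1) k { s with excluded := insert e s.excluded } where
  valid := by
    have := h.valid.insert_excl he (fun h' => h'.elim (fun h' => hf.1 (.inl h'))
      fun h' => hf.2 (.inl h')) (support_ne_card_of_head_mem hn hv he hp.head_mem)
    rwa [← Set.union_insert] at this
  init := h.init
  indet := h.indet
  source := h.source
  le_of_det := h.le_of_det
  le_of_excl := by
    rintro f (rfl | hf')
    exacts [hk.ge, h.le_of_excl f hf']
  copy_det := h.copy_det
  copy_excl f hf' hle := .inr (h.copy_excl f hf' hle)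
  cover f hf' hle := (h.cover f hf' hle).imp_left fun h' => h'.imp_right .inr

theorem Stage.accept (hn : 0 < n) {v : Votes n T} {o s : Status T}
    {k : ℕ} (h : Stage v o (k + 1) k s) {e : T × T} (he : IsPair v e)
    (hk : support v e.1 e.2 = k) (hf : Fresh o s e) (hp : ¬ s.AnyPath v e) :
    Stage v o (k + 1) k { s with determinate := insert e s.determinate } where
  valid := by
    have := h.valid.insert_det he (fun h' => h'.elim (fun h' => hf.1 (.inl h'))
      fun h' => hf.2 (.inl h')) (fun h' => h'.elim (fun h' => hf.1 (.inr h'))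
      fun h' => hf.2 (.inr h'))
      (h.support_ne_zero_of_not_detPath hn he hk fun h' => hp h'.anyPath) ?_
    · rwa [← Set.union_insert] at this
    · intro v' D hvv hv' hDX hD hpath
      refine hp (anyPath_of_extension hn hvv hv' he h.init ?_ ?_ hpath)
      · rintro x y ⟨hx, hy, hxy, -⟩
        exact ⟨hx, hy, (hD _ hxy).2⟩
      -- A heavier edge that is not excluded is already in `H`, since the heavier classes are
      -- complete. An equally heavy determinate edge is in `H` too: if it comes from the oracle, it
      -- has been copied.
      · rintro x y ⟨-, -, hxy, hor⟩ hxc hyc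
        rw [hvv.support_eq hn hv' _ hyc, hvv.support_eq hn hv' _ he.2.1, hk] at hor
        rcases hor with hlt | ⟨heq, hM | hM⟩
        · rcases h.cover (x, y) ⟨hxc, hyc, (hD _ hxy).1.2.2⟩ hlt with (h' | h') | h'
          · exact .inl ⟨x, y, rfl, rfl, h'⟩
          · exact absurd (.inr h') (hDX _ hxy)
          · exact .inr h'
        · exact .inl ⟨x, y, rfl, rfl, h.copy_det _ hM heq.ge⟩
        · exact .inl ⟨x, y, rfl, rfl, hM⟩
  init := h.init
  indet := h.indet
  source := h.source
  le_of_det := by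
    rintro f (rfl | hf')
    exacts [hk.ge, h.le_of_det f hf']
  le_of_excl := h.le_of_excl
  copy_det f hf' hle := .inr (h.copy_det f hf' hle)
  copy_excl := h.copy_excl
  cover f hf' hle := (h.cover f hf' hle).imp_left fun h' => h'.imp_left .inr

theorem Stage.addIndeterminate (hn : 0 < n) {v : Votes n T} (hv : ∀ i, (v i).Nodup)
    {o s : Status T} {k : ℕ} (h : Stage v o (k + 1) k s) {e : T × T} (he : IsPair v e)
    (hk : support v e.1 e.2 = k) (hd : ¬ s.DetPath v e) (hp : s.AnyPath v e)
    (hs : Source v s.indeterminate e) :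
    Stage v o (k + 1) k
      { s with indeterminate := insert (some e.1, some e.2) s.indeterminate } where
  valid := h.valid
  init := h.init.trans (Set.subset_insert _ _)
  indet := by
    rintro x y (h' | h')
    · cases h'
      exact .inr ⟨e.1, e.2, rfl, rfl, he, hk.ge, h.support_ne_zero_of_not_detPath hn he hk hd,
        support_ne_card_of_head_mem hn hv he hp.head_mem⟩
    · exact h.indet x y h'
  source := by
    rintro a b (h' | h')
    · cases h'
      exact hs.mono (Set.subset_insert _ _)
    · exact (h.source a b h').mono (Set.subset_insert _ _)
  le_of_det := h.le_of_det
  le_of_excl := h.le_of_excl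
  copy_det := h.copy_det
  copy_excl := h.copy_excl
  cover f hf' hle := (h.cover f hf' hle).imp_right .inr

end Invariants

/-! ### Preservation of the invariants by the algorithm -/

section Visits

variable {n : ℕ} {T : Type*}

theorem firstVisit_indeterminate (v : Votes n T) (s : Status T) (e : T × T) :
    (firstVisit v s e).indeterminate = s.indeterminate := by
  unfold firstVisit
  split_ifs <;> rfl

theorem decided_firstVisit_of_ne {v : Votes n T} {s : Status T} {e f : T × T} (h : f ≠ e) :
    (firstVisit v s e).Decided f ↔ s.Decided f := by
  unfold firstVisit
  split_ifs <;> simp [Status.Decided, h]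

theorem decided_finalVisit_of_ne {v : Votes n T} {s : Status T} {e f : T × T} (h : f ≠ e) :
    (finalVisit v s e).Decided f ↔ s.Decided f := by
  unfold finalVisit
  split_ifs <;> simp [Status.Decided, h]

theorem Status.Decided.firstVisit {v : Votes n T} {s : Status T} {e f : T × T}
    (h : s.Decided f) : (firstVisit v s e).Decided f := by
  unfold StreamingRP.firstVisit
  split_ifs
  exacts [h.imp_right .inr, h, h.imp_left .inr]

theorem Status.Decided.finalVisit {v : Votes n T} {s : Status T} {e f : T × T}
    (h : s.Decided f) : (finalVisit v s e).Decided f := by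
  unfold StreamingRP.finalVisit
  split_ifs
  exacts [h.imp_right .inr, h, h.imp_left .inr]

theorem indeterminate_subset_finalVisit (v : Votes n T) (s : Status T) (e : T × T) :
    s.indeterminate ⊆ (finalVisit v s e).indeterminate := by
  unfold finalVisit
  split_ifs
  exacts [Set.Subset.rfl, Set.subset_insert _ _, Set.Subset.rfl]

theorem settled_finalVisit (v : Votes n T) (s : Status T) (e : T × T) :
    (finalVisit v s e).Decided e ∨
      (some e.1, some e.2) ∈ (finalVisit v s e).indeterminate := by
  unfold finalVisit
  split_ifs <;> simp [Status.Decided]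

theorem Stage.firstVisit (hn : 0 < n) {v : Votes n T} (hv : ∀ i, (v i).Nodup) {o s : Status T}
    {k : ℕ} (h : Stage v o (k + 1) k s) {e : T × T} (he : IsPair v e)
    (hk : support v e.1 e.2 = k) (hf : Fresh o s e) :
    Stage v o (k + 1) k (firstVisit v s e) := by
  unfold StreamingRP.firstVisit
  split_ifs with h₁ h₂
  exacts [h.exclude hn hv he hk hf h₁, h, h.accept hn he hk hf h₂]

theorem decided_firstVisit_or_source {v : Votes n T} {o s : Status T} {c k : ℕ}
    (h : Stage v o c k s) {e : T × T}
    (hI : ∀ c d, (some c, some d) ∈ s.indeterminate → support v e.1 e.2 < support v c d) :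
    (StreamingRP.firstVisit v s e).Decided e ∨ Source v s.indeterminate e := by
  by_cases hs : Source v s.indeterminate e
  · exact .inr hs
  · left
    unfold StreamingRP.firstVisit
    split_ifs with h₁ h₂
    · exact .inr (Set.mem_insert _ _)
    · exact absurd (h₂.detPath hI h.none_none_notMem hs) h₁
    · exact .inl (Set.mem_insert _ _)

theorem Stage.finalVisit (hn : 0 < n) {v : Votes n T} (hv : ∀ i, (v i).Nodup) {o s : Status T}
    {k : ℕ} (h : Stage v o (k + 1) k s) {e : T × T} (he : IsPair v e)
    (hk : support v e.1 e.2 = k) (hf : Fresh o s e) (hs : Source v s.indeterminate e) :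
    Stage v o (k + 1) k (finalVisit v s e) := by
  unfold StreamingRP.finalVisit
  split_ifs with h₁ h₂
  exacts [h.exclude hn hv he hk hf h₁, h.addIndeterminate hn hv he hk h₁ h₂ hs,
    h.accept hn he hk hf h₂]

/-- This is what deferring is for: the first pass adds no indeterminate edge, so those between
transactions stay strictly heavier than the current class, and an edge left undecided has a source.
-/
theorem Stage.foldl_firstVisit (hn : 0 < n) {v : Votes n T} (hv : ∀ i, (v i).Nodup)
    {o : Status T} {k : ℕ} (l : List (T × T)) : ∀ s, l.Nodup →
    (∀ e ∈ l, IsPair v e ∧ support v e.1 e.2 = k ∧ Fresh o s e) → Stage v o (k + 1) k s →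
    (∀ c d, (some c, some d) ∈ s.indeterminate → k < support v c d) →
    Stage v o (k + 1) k (l.foldl (StreamingRP.firstVisit v) s) ∧
      (l.foldl (StreamingRP.firstVisit v) s).indeterminate = s.indeterminate ∧
      (∀ e ∈ l, (l.foldl (StreamingRP.firstVisit v) s).Decided e ∨ Source v s.indeterminate e) ∧
      ∀ e, s.Decided e → (l.foldl (StreamingRP.firstVisit v) s).Decided e := by
  induction l with
  | nil => exact fun s _ _ h _ => ⟨h, rfl, by simp, fun _ => id⟩
  | cons e l ih =>
    intro s hl he h hI
    obtain ⟨hel, hl'⟩ := List.nodup_cons.1 hl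
    obtain ⟨hp, hk, hf⟩ := he e (by simp)
    have hind := firstVisit_indeterminate v s e
    obtain ⟨h₁, h₂, h₃, h₄⟩ := ih (StreamingRP.firstVisit v s e) hl' (fun f hf' => by
      obtain ⟨q₁, q₂, q₃⟩ := he f (List.mem_cons_of_mem _ hf')
      have hne : f ≠ e := fun h' => hel (h' ▸ hf')
      exact ⟨q₁, q₂, q₃.1, fun h' => q₃.2 ((decided_firstVisit_of_ne hne).1 h')⟩)
      (h.firstVisit hn hv hp hk hf) (by rwa [hind])
    rw [hind] at h₂ h₃
    refine ⟨h₁, h₂, fun f hf' => ?_, fun f hf' => h₄ f hf'.firstVisit⟩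
    rcases List.mem_cons.1 hf' with rfl | hf'
    · exact (decided_firstVisit_or_source h (by rwa [hk])).imp_left (h₄ f)
    · exact h₃ f hf'

/-- Indeterminate edges of equal weight may now appear on the paths, but every deferred edge already
has a source, and sources persist as indeterminate edges are added. -/
theorem Stage.foldl_finalVisit (hn : 0 < n) {v : Votes n T} (hv : ∀ i, (v i).Nodup)
    {o : Status T} {k : ℕ} (l : List (T × T)) : ∀ s, l.Nodup →
    (∀ e ∈ l, IsPair v e ∧ support v e.1 e.2 = k ∧ Fresh o s e ∧ Source v s.indeterminate e) →
    Stage v o (k + 1) k s →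
    Stage v o (k + 1) k (l.foldl (StreamingRP.finalVisit v) s) ∧
      s.indeterminate ⊆ (l.foldl (StreamingRP.finalVisit v) s).indeterminate ∧
      (∀ e ∈ l, (l.foldl (StreamingRP.finalVisit v) s).Decided e ∨
        (some e.1, some e.2) ∈ (l.foldl (StreamingRP.finalVisit v) s).indeterminate) ∧
      ∀ e, s.Decided e → (l.foldl (StreamingRP.finalVisit v) s).Decided e := by
  induction l with
  | nil => exact fun s _ _ h => ⟨h, subset_rfl, by simp, fun _ => id⟩
  | cons e l ih =>
    intro s hl he h
    obtain ⟨hel, hl'⟩ := List.nodup_cons.1 hl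
    obtain ⟨hp, hk, hf, hs⟩ := he e (by simp)
    have hind := indeterminate_subset_finalVisit v s e
    obtain ⟨h₁, h₂, h₃, h₄⟩ := ih (StreamingRP.finalVisit v s e) hl' (fun f hf' => by
      obtain ⟨q₁, q₂, q₃, q₄⟩ := he f (List.mem_cons_of_mem _ hf')
      have hne : f ≠ e := fun h' => hel (h' ▸ hf')
      exact ⟨q₁, q₂, ⟨q₃.1, fun h' => q₃.2 ((decided_finalVisit_of_ne hne).1 h')⟩, q₄.mono hind⟩)
      (h.finalVisit hn hv hp hk hf hs)
    refine ⟨h₁, hind.trans h₂, fun f hf' => ?_, fun f hf' => h₄ f hf'.finalVisit⟩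
    rcases List.mem_cons.1 hf' with rfl | hf'
    · exact (settled_finalVisit v s f).imp (h₄ f) (fun h' => h₂ h')
    · exact h₃ f hf'

/-- `Stage.valid` speaks of the union with the oracle's decisions, so copying some of them leaves it
unchanged. -/
theorem Stage.copy (hn : 0 < n) {v : Votes n T} {o s : Status T} {k : ℕ}
    (h : Stage v o (k + 1) (k + 1) s) : Stage v o (k + 1) k
      { s with
        determinate := s.determinate ∪ {e | e ∈ weightClass v k ∧ e ∈ o.determinate}
        excluded := s.excluded ∪ {e | e ∈ weightClass v k ∧ e ∈ o.excluded} } where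
  valid := by
    have h₁ : o.determinate ∪ (s.determinate ∪ {e | e ∈ weightClass v k ∧ e ∈ o.determinate}) =
        o.determinate ∪ s.determinate := by
      ext e
      simp only [Set.mem_union, Set.mem_ofPred_eq]
      tauto
    have h₂ : o.excluded ∪ (s.excluded ∪ {e | e ∈ weightClass v k ∧ e ∈ o.excluded}) =
        o.excluded ∪ s.excluded := by
      ext e
      simp only [Set.mem_union, Set.mem_ofPred_eq]
      tauto
    rw [h₁, h₂]
    exact h.valid
  init := h.init
  indet x y hxy := by
    rcases h.indet x y hxy with h' | ⟨a, b, hx, hy, h₁, h₂, h₃⟩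
    exacts [.inl h', .inr ⟨a, b, hx, hy, h₁, by omega, h₃⟩]
  source := h.source
  le_of_det := by
    rintro e (he | ⟨he, -⟩)
    · have := h.le_of_det e he
      omega
    · exact ((mem_weightClass hn).1 he).2.ge
  le_of_excl := by
    rintro e (he | ⟨he, -⟩)
    · have := h.le_of_excl e he
      omega
    · exact ((mem_weightClass hn).1 he).2.ge
  copy_det e he hk := by
    rcases hk.lt_or_eq with hk | hk
    · exact .inl (h.copy_det e he hk)
    · exact .inr ⟨(mem_weightClass hn).2 ⟨h.valid.pair_det e (.inl he), hk.symm⟩, he⟩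
  copy_excl e he hk := by
    rcases hk.lt_or_eq with hk | hk
    · exact .inl (h.copy_excl e he hk)
    · exact .inr ⟨(mem_weightClass hn).2 ⟨h.valid.pair_excl e (.inl he), hk.symm⟩, he⟩
  cover e he hk := (h.cover e he hk).imp_left fun h' => h'.imp .inl .inl

theorem Stage.classPass (hn : 0 < n) (impl : Implementation n T) {v : Votes n T}
    (hv : ∀ i, (v i).Nodup) {o s : Status T} {k : ℕ} (h : Stage v o (k + 1) (k + 1) s) :
    Stage v o k k (classPass impl o v s k) := by
  classical
  unfold StreamingRP.classPass
  extract_lets copied todo visited deferred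
  have hcopied : Stage v o (k + 1) k copied := h.copy hn
  have hmem : ∀ e, e ∈ todo ↔ (IsPair v e ∧ support v e.1 e.2 = k) ∧ ¬ o.Decided e := by
    intro e
    rw [impl.mem_order, Finset.mem_filter, mem_weightClass hn]
  have hnd : todo.Nodup := impl.order_nodup _ _
  have hfresh : ∀ e ∈ todo, IsPair v e ∧ support v e.1 e.2 = k ∧ Fresh o copied e := by
    intro e he
    obtain ⟨⟨h₁, h₂⟩, h₃⟩ := (hmem e).1 he
    refine ⟨h₁, h₂, h₃, ?_⟩
    rintro ((h' | h') | (h' | h'))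
    · have := h.le_of_det e h'
      omega
    · exact h₃ (.inl h'.2)
    · have := h.le_of_excl e h'
      omega
    · exact h₃ (.inr h'.2)
  obtain ⟨v₁, v₂, v₃, v₄⟩ := Stage.foldl_firstVisit hn hv todo copied hnd hfresh hcopied
    fun c d hcd => (h.indet_pair hcd).2.1
  have hdef : ∀ e, e ∈ deferred ↔ e ∈ todo ∧ ¬ visited.Decided e := by
    intro e
    simp [deferred]
  obtain ⟨w₁, w₂, w₃, w₄⟩ := Stage.foldl_finalVisit hn hv deferred visited (hnd.filter _)
    (fun e he => by
      obtain ⟨h₁, h₂⟩ := (hdef e).1 he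
      obtain ⟨h₃, h₄, h₅⟩ := hfresh e h₁
      refine ⟨h₃, h₄, ⟨h₅.1, h₂⟩, ?_⟩
      rw [v₂]
      exact (v₃ e h₁).resolve_left h₂) v₁
  refine { w₁ with cover := fun e he hk => ?_ }
  rcases hk.lt_or_eq with hk | hk
  · exact w₁.cover e he hk
  · by_cases ho : o.Decided e
    · exact .inl (ho.imp (fun h' => w₁.copy_det e h' hk.le) fun h' => w₁.copy_excl e h' hk.le)
    · have ht : e ∈ todo := (hmem e).2 ⟨⟨he, hk.symm⟩, ho⟩
      by_cases hd : visited.Decided e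
      · exact .inl (w₄ e hd)
      · exact w₃ e ((hdef e).2 ⟨ht, hd⟩)

theorem stage_initialStatus {v : Votes n T} {o : Status T}
    (h : Valid v o.determinate o.excluded) : Stage v o (n + 1) (n + 1) (initialStatus v) where
  valid := by simpa [initialStatus] using h
  init := subset_rfl
  indet _ _ h' := .inl h'
  source a b h' := absurd h' (some_some_notMem_initialStatus v a b)
  le_of_det := by simp [initialStatus]
  le_of_excl := by simp [initialStatus]
  copy_det e _ hk := absurd hk (support_le v e.1 e.2).not_gt
  copy_excl e _ hk := absurd hk (support_le v e.1 e.2).not_gt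
  cover e _ hk := absurd hk (support_le v e.1 e.2).not_gt

theorem stage_invocation (hn : 0 < n) (impl : Implementation n T) {v : Votes n T}
    (hv : ∀ i, (v i).Nodup) {o : Status T} (h : Valid v o.determinate o.excluded) :
    Stage v o 0 0 (invocation impl o v) := by
  have key : ∀ j s, Stage v o j j s →
      Stage v o 0 0 ((List.range j).reverse.foldl (classPass impl o v) s) := by
    intro j
    induction j with
    | zero => exact fun s hs => hs
    | succ j ih =>
      intro s hs
      rw [List.range_succ, List.reverse_append, List.reverse_singleton, List.singleton_append,
        List.foldl_cons]
      exact ih _ (hs.classPass hn impl hv)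
  exact key _ _ (stage_initialStatus h)

theorem Stage.valid_status {v : Votes n T} {o s : Status T} (h : Stage v o 0 0 s) :
    Valid v s.determinate s.excluded := by
  have := h.valid
  rwa [Set.union_eq_self_of_subset_left fun e he => h.copy_det e he (Nat.zero_le _),
    Set.union_eq_self_of_subset_left fun e he => h.copy_excl e he (Nat.zero_le _)] at this

instance : IsTrans (Votes n T) Votes.ExtendedBy := ⟨fun _ _ _ => Votes.ExtendedBy.trans⟩

theorem valid_foldl_invocation (hn : 0 < n) (impl : Implementation n T) {v : Votes n T}
    (hv : ∀ i, (v i).Nodup) (l : List (Votes n T)) : ∀ (w : Votes n T) (o : Status T),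
    (w :: (l ++ [v])).Pairwise Votes.ExtendedBy → Valid w o.determinate o.excluded →
    Valid v (l.foldl (invocation impl) o).determinate
      (l.foldl (invocation impl) o).excluded := by
  induction l with
  | nil =>
    intro w o hl h
    exact h.extend hn ((List.pairwise_cons.1 hl).1 v (by simp)) hv
  | cons x l ih =>
    intro w o hl h
    obtain ⟨h₁, h₂⟩ := List.pairwise_cons.1 hl
    have hx : ∀ i, (x i).Nodup :=
      Votes.ExtendedBy.nodup ((List.pairwise_cons.1 h₂).1 v (by simp)) hv
    exact ih x _ h₂
      (stage_invocation hn impl hx (h.extend hn (h₁ x (by simp)) hx)).valid_status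

theorem exists_stage_finalStatus (hn : 0 < n) (impl : Implementation n T) {v : Votes n T}
    (hv : ∀ i, (v i).Nodup) : ∃ o, Stage v o 0 0 (finalStatus impl v) := by
  unfold finalStatus
  rw [List.foldl_append, List.foldl_cons, List.foldl_nil]
  refine ⟨_, stage_invocation hn impl hv
    -- Empty votes, which all votes extend, serve as the stage before the oldest invocation.
    (valid_foldl_invocation hn impl hv _ (fun _ => []) _ ?_ (Valid.empty _))⟩
  exact List.pairwise_cons.2 ⟨fun _ _ _ => List.nil_prefix,
    List.isChain_iff_pairwise.1 (impl.past_chain v)⟩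

end Visits

/-! ### Acyclicity of the determinate edges -/

section Acyclicity

variable {n : ℕ} {T : Type*}

/-- Edges are inserted by decreasing weight and, within a weight, increasing rank. If the last one
closes a cycle, the rest of the cycle is a path forbidden by `Blocks`, applied to the votes
themselves with `D = M`, provided that it stays among the local vertices. -/
theorem Valid.acyclic (hn : 0 < n) {v : Votes n T} (hv : ∀ i, (v i).Nodup) {M X : Set (T × T)}
    (h : Valid v M X) (hM : ∀ e, IsPair v e → support v e.1 e.2 = n → e ∈ M) (a : T) :
    ¬ Relation.TransGen (fun x y => (x, y) ∈ M) a a := by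
  classical
  have hfin : M.Finite := (common v ×ˢ common v).finite_toSet.subset fun e he => by
    have := h.pair_det e he
    simp [this.1, this.2.1]
  obtain ⟨r, B, hr⟩ := h.blocks
  -- All unanimous edges are present from the start, so that they can serve as shortcuts below;
  -- alone they are acyclic, as they agree with any single vote.
  let E : Finset (T × T) → T → T → Prop := fun S x y =>
    (x, y) ∈ S ∨ (IsPair v (x, y) ∧ support v x y = n)
  have hE : ∀ S : Finset (T × T), (∀ e ∈ S, e ∈ M) → ∀ x y, E S x y → (x, y) ∈ M := by
    rintro S hS x y (hxy | ⟨h₁, h₂⟩)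
    exacts [hS _ hxy, hM _ h₁ h₂]
  have key : ∀ S : Finset (T × T), (∀ e ∈ S, e ∈ M) → ∀ a, ¬ Relation.TransGen (E S) a a := by
    intro S
    induction S using Finset.induction_on_max_value
      (fun e : T × T => toLex (n - support v e.1 e.2, r e)) with
    | empty =>
      intro _ a ha
      have : ∀ x y, Relation.TransGen (E ∅) x y →
          (v ⟨0, hn⟩).idxOf x < (v ⟨0, hn⟩).idxOf y := by
        have hone : ∀ x y, E ∅ x y → (v ⟨0, hn⟩).idxOf x < (v ⟨0, hn⟩).idxOf y := by
          rintro x y (hxy | ⟨-, hxy⟩)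
          · simp at hxy
          · exact (support_eq_iff.1 hxy _).idxOf_lt (hv _)
        intro x y hxy
        induction hxy with
        | single h' => exact hone _ _ h'
        | tail _ h' ih => exact ih.trans (hone _ _ h')
      exact lt_irrefl _ (this a a ha)
    | insert e S heS hmax ih =>
      intro hS x hx
      have hSM : ∀ f ∈ S, f ∈ M := fun f hf => hS f (Finset.mem_insert_of_mem hf)
      have heM : e ∈ M := hS e (Finset.mem_insert_self _ _)
      have ih' := ih hSM
      have hpair := h.pair_det e heM
      by_cases hone : support v e.1 e.2 = n
      · refine ih' x (Relation.TransGen.mono ?_ _ _ hx)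
        rintro y z (hyz | hyz)
        · rcases Finset.mem_insert.1 hyz with rfl | hyz
          exacts [.inr ⟨hpair, hone⟩, .inl hyz]
        · exact .inr hyz
      have hcyc : Relation.TransGen (fun p q => E S p q ∨ (p = e.1 ∧ q = e.2)) x x := by
        refine Relation.TransGen.mono ?_ _ _ hx
        rintro y z (hyz | hyz)
        · rcases Finset.mem_insert.1 hyz with rfl | hyz
          exacts [.inr ⟨rfl, rfl⟩, .inl (.inl hyz)]
        · exact .inl (.inr hyz)
      rcases transGen_insert_edge hcyc with hcyc | ⟨h₁, h₂⟩
      · exact ih' x hcyc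
      have hba : Relation.TransGen (E S) e.2 e.1 :=
        (Relation.reflTransGen_iff_eq_or_transGen.1 (h₂.trans h₁)).resolve_left hpair.2.2
      -- If `z` were not local, a unanimous edge from `e.1` to `z` or from `z` to `e.2` would close
      -- a cycle without `e`, against the induction hypothesis.
      have hU : ∀ z, Relation.ReflTransGen (E S) e.2 z → Relation.ReflTransGen (E S) z e.1 →
          z ∈ {z | some z ∈ localVertices v e.1 e.2} := by
        intro z hz hz'
        have hzc : z ∈ common v := by
          rcases hz.cases_tail with h' | ⟨y, -, hy⟩
          · exact h' ▸ hpair.2.1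
          · exact (h.pair_det _ (hE S hSM _ _ hy)).2.1
        refine (some_mem_localVertices hn).2 ⟨hzc, ?_, ?_⟩
        · by_contra! hc
          have hp : IsPair v (z, e.1) := ⟨hzc, hpair.1, hc.1⟩
          exact ih' _ (Relation.TransGen.head'
            (.inr ⟨hp.swap, support_swap_of_eq_zero hn hp hc.2⟩) hz')
        · by_contra! hc
          exact ih' _ (Relation.TransGen.head' (.inr ⟨⟨hzc, hpair.2.1, hc.1⟩, hc.2⟩) hz)
      refine (hr e heM).2 v M (Votes.ExtendedBy.refl v) hv h.disjoint
        (fun f hf => ⟨h.pair_det f hf, h.det_ne_zero f hf⟩)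
        (Relation.TransGen.mono ?_ _ _ (transGen_restrict hba hU))
      rintro y z ⟨hy, hz, hyz⟩
      refine ⟨hy, hz, hE S hSM _ _ hyz, ?_⟩
      have hle := support_le v e.1 e.2
      have hle' := support_le v y z
      rcases hyz with hyz | ⟨-, hyz⟩
      · rcases (Prod.Lex.toLex_le_toLex.1 (hmax _ hyz)) with hlt | ⟨heq, hre⟩
        · left
          simp only at hlt
          omega
        · right
          simp only at heq hre
          exact ⟨by omega, hSM _ hyz, fun h' => heS (h' ▸ hyz), hre⟩
      · left
        omega
  exact fun ha => key hfin.toFinset (by simp) a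
    (Relation.TransGen.mono (fun x y hxy => .inl (by simpa using hxy)) _ _ ha)

end Acyclicity

/-! ### Disappearance of indeterminacy and liveness -/

section Liveness

open Filter

variable {n : ℕ} {T : Type*}

theorem truncation_extendedBy (σ : Fin n → ℕ → T) {N N' : ℕ} (h : N ≤ N') :
    (truncation σ N).ExtendedBy (truncation σ N') := fun i => by
  obtain ⟨k, rfl⟩ := Nat.exists_eq_add_of_le h
  unfold truncation
  rw [List.range_add, List.map_append]
  exact List.prefix_append _ _

theorem nodup_truncation {σ : Fin n → ℕ → T} (hσ : ∀ i, Function.Injective (σ i)) (N : ℕ)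
    (i : Fin n) : (truncation σ N i).Nodup := List.nodup_range.map (hσ i)

theorem eventually_mem_common (hn : 0 < n) {σ : Fin n → ℕ → T}
    (hr : ∀ i j, Set.range (σ i) = Set.range (σ j)) {a : T} (ha : ∃ i, a ∈ Set.range (σ i)) :
    ∀ᶠ N in atTop, a ∈ common (truncation σ N) := by
  obtain ⟨j, hj⟩ := ha
  have : ∀ i, ∀ᶠ N in atTop, a ∈ truncation σ N i := by
    intro i
    obtain ⟨m, hm⟩ := hr j i ▸ hj
    filter_upwards [eventually_gt_atTop m] with N hN
    exact List.mem_map.2 ⟨m, List.mem_range.2 hN, hm⟩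
  filter_upwards [eventually_all.2 this] with N hN
  exact (mem_common hn).2 hN

open scoped Classical in
/-- The transactions that occur in at least one vote. -/
noncomputable def occurring (v : Votes n T) : Finset T :=
  Finset.univ.biUnion fun i => (v i).toFinset

theorem mem_occurring {v : Votes n T} {a : T} : a ∈ occurring v ↔ ∃ i, a ∈ v i := by
  simp [occurring]

theorem mem_occurring_of_mem_common (hn : 0 < n) {v : Votes n T} {a : T} (h : a ∈ common v) :
    a ∈ occurring v := mem_occurring.2 ⟨⟨0, hn⟩, (mem_common hn).1 h _⟩

theorem Votes.ExtendedBy.mem_occurring_of_support_ne_zero (hn : 0 < n) {v v' : Votes n T}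
    (h : v.ExtendedBy v') (hv : ∀ i, (v' i).Nodup) {a b : T} (hb : b ∈ common v)
    (hs : support v' a b ≠ 0) : a ∈ occurring v := by
  rw [h.support_eq hn hv _ hb] at hs
  obtain ⟨i, hi⟩ := support_ne_zero.1 hs
  exact mem_occurring.2 ⟨i, hi.mem_left⟩

theorem eventually_mem_common_of_mem_occurring (hn : 0 < n) {σ : Fin n → ℕ → T}
    (hr : ∀ i j, Set.range (σ i) = Set.range (σ j)) {N : ℕ} {a : T}
    (ha : a ∈ occurring (truncation σ N)) : ∀ᶠ N' in atTop, a ∈ common (truncation σ N') := by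
  obtain ⟨i, hi⟩ := mem_occurring.1 ha
  obtain ⟨m, -, hm⟩ := List.mem_map.1 hi
  exact eventually_mem_common hn hr ⟨i, m, hm⟩

/-- An edge from the future vertex to `a` needs a predecessor of `a` that is not yet common. The
predecessors of `a` form a fixed finite set, and each of them becomes common. -/
theorem eventually_none_some_notMem (hn : 0 < n) {σ : Fin n → ℕ → T}
    (hσ : ∀ i, Function.Injective (σ i)) (hr : ∀ i j, Set.range (σ i) = Set.range (σ j))
    {N₀ : ℕ} {a : T} (ha : a ∈ common (truncation σ N₀)) :
    ∀ᶠ N in atTop, (none, some a) ∉ (initialStatus (truncation σ N)).indeterminate := by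
  have hF : ∀ᶠ N in atTop, ∀ c ∈ occurring (truncation σ N₀), c ∈ common (truncation σ N) :=
    (eventually_all_finset _).2 fun c hc => eventually_mem_common_of_mem_occurring hn hr hc
  filter_upwards [hF, eventually_ge_atTop N₀] with N hN hN₀ hmem
  obtain ⟨-, c, -, ⟨i, hi⟩, j, hj⟩ := none_some_mem_initialStatus.1 hmem
  refine hi ((mem_common hn).1 (hN c ?_) i)
  exact (truncation_extendedBy σ hN₀).mem_occurring_of_support_ne_zero hn
    (nodup_truncation hσ N) ha (support_ne_zero.2 ⟨j, hj⟩)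

/-- By induction on the number of replicas not supporting the edge, both kinds of source eventually
vanish, since the local vertices never leave the finite set of transactions occurring at stage `N₀`.
-/
theorem eventually_pair_notMem (hn : 0 < n) (impl : Implementation n T) {σ : Fin n → ℕ → T}
    (hσ : ∀ i, Function.Injective (σ i)) (hr : ∀ i j, Set.range (σ i) = Set.range (σ j))
    {N₀ : ℕ} {a b : T} (hab : IsPair (truncation σ N₀) (a, b)) :
    ∀ᶠ N in atTop, (some a, some b) ∉ (finalStatus impl (truncation σ N)).indeterminate := by
  induction hd : n - support (truncation σ N₀) a b using Nat.strong_induction_on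
    generalizing a b N₀ with
  | _ d ih =>
  subst hd
  have hfut : ∀ᶠ N in atTop, ∀ c ∈ occurring (truncation σ N₀),
      (none, some c) ∉ (initialStatus (truncation σ N)).indeterminate := by
    refine (eventually_all_finset _).2 fun c hc => ?_
    obtain ⟨N₁, hN₁⟩ := (eventually_mem_common_of_mem_occurring hn hr hc).exists
    exact eventually_none_some_notMem hn hσ hr hN₁
  have hheavy : ∀ᶠ N in atTop, ∀ c ∈ occurring (truncation σ N₀),
      ∀ d ∈ occurring (truncation σ N₀), IsPair (truncation σ N) (c, d) →
      support (truncation σ N) a b < support (truncation σ N) c d →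
      (some c, some d) ∉ (finalStatus impl (truncation σ N)).indeterminate := by
    refine (eventually_all_finset _).2 fun c hc => (eventually_all_finset _).2 fun d hd => ?_
    by_cases hcd : c = d
    · exact Eventually.of_forall fun N hp => absurd hcd hp.2.2
    obtain ⟨N₁, hc₁, hd₁⟩ := ((eventually_mem_common_of_mem_occurring hn hr hc).and
      (eventually_mem_common_of_mem_occurring hn hr hd)).exists
    by_cases hlt : support (truncation σ N₀) a b < support (truncation σ N₁) c d
    · have := support_le (truncation σ N₁) c d
      filter_upwards [ih _ (by omega) (N₀ := N₁) ⟨hc₁, hd₁, hcd⟩ rfl] with N hN _ _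
      exact hN
    -- Both supports are frozen by now, so an edge that is not heavier never becomes so.
    · filter_upwards [eventually_ge_atTop N₀, eventually_ge_atTop N₁] with N h₀ h₁ _ hlt'
      rw [(truncation_extendedBy σ h₀).support_eq hn (nodup_truncation hσ N) _ hab.2.1,
        (truncation_extendedBy σ h₁).support_eq hn (nodup_truncation hσ N) _ hd₁] at hlt'
      exact absurd hlt' hlt
  filter_upwards [hfut, hheavy, eventually_ge_atTop N₀] with N h₁ h₂ h₀ hmem
  have hext := truncation_extendedBy σ h₀
  have hv := nodup_truncation hσ N
  obtain ⟨o, hst⟩ := exists_stage_finalStatus hn impl hv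
  have hU : ∀ c, some c ∈ localVertices (truncation σ N) a b →
      c ∈ occurring (truncation σ N₀) := by
    intro c hc
    rcases ((some_mem_localVertices hn).1 hc).2.1 with rfl | hs
    · exact mem_occurring_of_mem_common hn hab.1
    · exact hext.mem_occurring_of_support_ne_zero hn hv hab.1 hs
  rcases hst.source a b hmem with ⟨y, hy, hI⟩ | ⟨c, d, hc, hd, hI, hlt⟩
  · rcases hst.indet _ _ hI with hI | ⟨_, _, hx, -⟩
    · exact h₁ y (hU y hy) hI
    · cases hx
  · exact h₂ c (hU c hc) d (hU d hd) (hst.indet_pair hI).1 hlt hI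

theorem asymptoticallyLive_streamingRankedPairs (impl : Implementation n T) :
    AsymptoticallyLive (streamingRankedPairs impl) := by
  intro σ hσ hr τ hτ
  have hn : 0 < n := Fin.pos hτ.choose
  obtain ⟨N₀, hN₀⟩ := (eventually_mem_common hn hr hτ).exists
  have hF : ∀ᶠ N in atTop, ∀ c ∈ occurring (truncation σ N₀), c ∈ common (truncation σ N) :=
    (eventually_all_finset _).2 fun c hc => eventually_mem_common_of_mem_occurring hn hr hc
  -- At `N₁` everything occurring at `N₀` is common, so its predecessors all occur at `N₁`. This
  -- leaves finitely many pairs for `hpair` to treat.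
  obtain ⟨N₁, hN₁⟩ := hF.exists
  have hfut : ∀ᶠ N in atTop, ∀ c ∈ occurring (truncation σ N₀),
      (none, some c) ∉ (initialStatus (truncation σ N)).indeterminate :=
    (eventually_all_finset _).2 fun c hc => eventually_none_some_notMem hn hσ hr (hN₁ c hc)
  have hpair : ∀ᶠ N in atTop, ∀ c ∈ occurring (truncation σ N₁),
      ∀ d ∈ occurring (truncation σ N₁), c ≠ d →
      (some c, some d) ∉ (finalStatus impl (truncation σ N)).indeterminate := by
    refine (eventually_all_finset _).2 fun c hc => (eventually_all_finset _).2 fun d hd => ?_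
    obtain ⟨N₂, hc₂, hd₂⟩ := ((eventually_mem_common_of_mem_occurring hn hr hc).and
      (eventually_mem_common_of_mem_occurring hn hr hd)).exists
    by_cases hcd : c = d
    · exact Eventually.of_forall fun N h => absurd hcd h
    · filter_upwards [eventually_pair_notMem hn impl hσ hr (N₀ := N₂) ⟨hc₂, hd₂, hcd⟩] with N hN _
      exact hN
  obtain ⟨N, hfutN, hpairN, hle₀, hle₁⟩ := (hfut.and (hpair.and
    ((eventually_ge_atTop N₀).and (eventually_ge_atTop N₁)))).exists
  refine ⟨N, ?_⟩
  have hv := nodup_truncation hσ N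
  have hext₀ := truncation_extendedBy σ hle₀
  have hext₁ := truncation_extendedBy σ hle₁
  obtain ⟨o, hst⟩ := exists_stage_finalStatus hn impl hv
  have hborders : ∀ x ∈ occurring (truncation σ N₀),
      ¬ (finalStatus impl (truncation σ N)).Borders x := by
    intro x hx
    have hx₁ := mem_occurring_of_mem_common hn (hN₁ x hx)
    have hnear : ∀ y, support (truncation σ N) y x ≠ 0 → y ∈ occurring (truncation σ N₁) :=
      fun y hy => hext₁.mem_occurring_of_support_ne_zero hn hv (hN₁ x hx) hy
    rintro ⟨_ | y, h | ⟨hne, h⟩⟩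
    · rcases hst.indet _ _ h with h | ⟨_, _, h, -⟩
      · exact hfutN x hx h
      · cases h
    · exact hne rfl
    · obtain ⟨hp, -, h0, -⟩ := hst.indet_pair h
      exact hpairN y (hnear y h0) x hx₁ hp.2.2 h
    -- An outgoing indeterminate edge is not unanimous, so `y` precedes `x` in some vote and lies in
    -- the same finite set.
    · obtain ⟨hp, -, -, h1⟩ := hst.indet_pair h
      exact hpairN x hx₁ y (hnear y fun h0 => h1 (support_swap_of_eq_zero hn hp.swap h0))
        hp.2.2 h
  have hacyc := hst.valid_status.acyclic hn hv
    fun e he hs => hst.mem_det_of_support_eq (Nat.zero_le _) he hs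
  obtain ⟨-, hmem, hpw⟩ := impl.sort_spec (common (truncation σ N))
    (finalStatus impl (truncation σ N)).determinate
    fun a ha => hacyc a (Relation.TransGen.mono (fun _ _ h => h.2.2) _ _ ha)
  have hτN := hext₀.mem_common hn hN₀
  have hτ₀ := mem_occurring_of_mem_common hn hN₀
  refine mem_takeWhile_of_pairwise hpw ((hmem τ).2 hτN) (by simpa using hborders τ hτ₀) ?_
  -- A bordering transaction `x` is new since `N₀`, hence unanimously ranked after `τ`; the
  -- determinate edge from `τ` to `x` keeps it from standing before `τ` in the sort.
  intro x hx hb hdet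
  have hx₀ : x ∉ occurring (truncation σ N₀) := fun hx₀ => hborders x hx₀ (by simpa using hb)
  have hp : IsPair (truncation σ N) (x, τ) :=
    ⟨(hmem x).1 hx, hτN, fun h' => hx₀ ((show x = τ from h') ▸ hτ₀)⟩
  have h0 : support (truncation σ N) x τ = 0 := by
    by_contra h0
    exact hx₀ (hext₀.mem_occurring_of_support_ne_zero hn hv hN₀ h0)
  exact hdet (hst.mem_det_of_support_eq (Nat.zero_le _) hp.swap
    (support_swap_of_eq_zero hn hp h0))

end Liveness

end StreamingRP

theorem mainTheorem2 {T : Type*} (n : ℕ) (impl : StreamingRP.Implementation n T) :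
    StreamingRP.AsymptoticallyLive (StreamingRP.streamingRankedPairs impl) :=
  StreamingRP.asymptoticallyLive_streamingRankedPairs impl
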